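/- Let \(n\ge 0\) and let \(\mathrm{Aff}(n,\mathbb{C})\) be the group, under composition, of the affine transformations \(g=(A,v)\colon x\mapsto Ax+v\) of \(\mathbb{C}^n\), where \(A\in\mathrm{GL}(n,\mathbb{C})\) and \(v\in\mathbb{C}^n\). For \(g=(A,v)\) put \(\overline{g}=(\overline{A},\overline{v})\), with entrywise complex conjugation, and call \(g\) a coninvolution if \(g\,\overline{g}=e=(I_n,0)\). Then every element \(g=(A,v)\in\mathrm{Aff}(n,\mathbb{C})\) with \(|\det(A)|=1\) can be expressed as a product of at most four coninvolutions in \(\mathrm{Aff}(n,\mathbb{C})\). -/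

import Mathlib

open scoped Matrix

/-- The group of affine transformations of `ℂⁿ` under composition:
`(g * h) x = g (h x)`. -/
abbrev Aff (n : ℕ) : Type := (Fin n → ℂ) ≃ᵃ[ℂ] (Fin n → ℂ)

namespace Aff

/-- The affine transformation `(A, v) : x ↦ A x + v`. -/
noncomputable def ofPair {n : ℕ} (A : GL (Fin n) ℂ) (v : Fin n → ℂ) : Aff n where
  toFun x := (A : Matrix (Fin n) (Fin n) ℂ) *ᵥ x + v
  invFun x := ((A⁻¹ : GL (Fin n) ℂ) : Matrix (Fin n) (Fin n) ℂ) *ᵥ (x - v)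
  left_inv x := by
    beta_reduce
    rw [add_sub_cancel_right, Matrix.mulVec_mulVec, ← Units.val_mul, inv_mul_cancel,
      Units.val_one, Matrix.one_mulVec]
  right_inv x := by
    beta_reduce
    rw [Matrix.mulVec_mulVec, ← Units.val_mul, mul_inv_cancel, Units.val_one,
      Matrix.one_mulVec, sub_add_cancel]
  linear := LinearMap.GeneralLinearGroup.generalLinearEquiv ℂ _ (Matrix.GeneralLinearGroup.toLin A)
  map_vadd' p u := by
    change (A : Matrix (Fin n) (Fin n) ℂ) *ᵥ (u + p) + v =
      (A : Matrix (Fin n) (Fin n) ℂ) *ᵥ u + ((A : Matrix (Fin n) (Fin n) ℂ) *ᵥ p + v)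
    rw [Matrix.mulVec_add, add_assoc]

/-- The linear part `L(g) = A` of `g = (A, v)`, as an invertible matrix. -/
noncomputable def linearPart {n : ℕ} (g : Aff n) : GL (Fin n) ℂ :=
  Matrix.GeneralLinearGroup.toLin.symm
    ((LinearMap.GeneralLinearGroup.generalLinearEquiv ℂ (Fin n → ℂ)).symm g.linear)

/-- The translation part `v` of `g = (A, v)`. -/
def translationPart {n : ℕ} (g : Aff n) : Fin n → ℂ := g 0

@[simp] theorem ofPair_apply {n : ℕ} (A : GL (Fin n) ℂ) (v x : Fin n → ℂ) :
    ofPair A v x = (A : Matrix (Fin n) (Fin n) ℂ) *ᵥ x + v := rfl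

@[simp] theorem linearPart_ofPair {n : ℕ} (A : GL (Fin n) ℂ) (v : Fin n → ℂ) :
    linearPart (ofPair A v) = A := by
  simp [linearPart, ofPair]

@[simp] theorem translationPart_ofPair {n : ℕ} (A : GL (Fin n) ℂ) (v : Fin n → ℂ) :
    translationPart (ofPair A v) = v := by
  simp [translationPart]

theorem linearPart_mulVec {n : ℕ} (g : Aff n) (x : Fin n → ℂ) :
    (linearPart g : Matrix (Fin n) (Fin n) ℂ) *ᵥ x = g.linear x := by
  change Matrix.toLin' (LinearMap.toMatrix' (g.linear : (Fin n → ℂ) →ₗ[ℂ] (Fin n → ℂ))) x = _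
  rw [Matrix.toLin'_toMatrix']
  rfl

/-- Every affine transformation of `ℂⁿ` is `(A, v)` for its linear and translation parts. -/
theorem ofPair_linearPart_translationPart {n : ℕ} (g : Aff n) :
    ofPair (linearPart g) (translationPart g) = g := by
  ext1 x
  rw [ofPair_apply, linearPart_mulVec, translationPart]
  simpa using (g.map_vadd 0 x).symm

/-- The complex conjugate `(Ā, v̄)` of `g = (A, v)`, with entrywise conjugation. -/
noncomputable def conj {n : ℕ} (g : Aff n) : Aff n :=
  ofPair (Matrix.GeneralLinearGroup.map (starRingEnd ℂ) (linearPart g))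
    (star (translationPart g))

/-- `g` is a coninvolution if `g ḡ = e`, where `e = (I, 0)` is the identity. -/
def IsConinvolution {n : ℕ} (g : Aff n) : Prop := g * conj g = 1

end Aff

/-! A coninvolution `d` conjugated by any `h` splits as `h d h⁻¹ = (h d h̄⁻¹)(h̄ h⁻¹)`, two
coninvolutions. A unimodular diagonal matrix is a coninvolution, so an affine map with a fixed point
and a linear part similar to such a matrix costs two factors.

It remains to write `g = (B, v)(C, 0)` with both factors of this kind. For nonscalar `A`, Sourour's
theorem gives `A = B C` with any prescribed nonzero eigenvalues whose total product is `det A`.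
Taking them unimodular and distinct within each factor makes `B` and `C` diagonalizable; keeping 1
out of the spectrum of `B` gives `(B, v)` a fixed point. Scalar `A` is `(-I)(-A)`. -/

namespace Matrix

/-- `A` is a product of two matrices whose characteristic polynomials have the prescribed roots. -/
def HasSpectralFactorization {K m ι : Type*} [Field K] [Fintype m] [DecidableEq m] [Fintype ι]
    (A : Matrix m m K) (β γ : ι → K) : Prop :=
  ∃ B C : Matrix m m K, A = B * C ∧ B.charpoly = ∏ i, (Polynomial.X - Polynomial.C (β i)) ∧
    C.charpoly = ∏ i, (Polynomial.X - Polynomial.C (γ i))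

/-! ### Similarity invariance -/

section
variable {K m ι : Type*} [Field K] [Fintype m] [DecidableEq m] [Fintype ι]

theorem charpoly_conj_of_mul_eq_one {P Q : Matrix m m K} (h : P * Q = 1) (A : Matrix m m K) :
    (Q * A * P).charpoly = A.charpoly := by
  have h' : Q * P = 1 := mul_eq_one_comm.mp h
  have := charpoly_units_conj ⟨Q, P, h', h⟩ A
  rwa [inv_eq_right_inv h'] at this

theorem det_mul_mul_of_mul_eq_one {P Q : Matrix m m K} (h : P * Q = 1) (A : Matrix m m K) :
    (P * A * Q).det = A.det := by
  have : P.det * Q.det = 1 := by rw [← det_mul, h, det_one]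
  rw [det_mul, det_mul]; linear_combination A.det * this

theorem HasSpectralFactorization.of_conj {P Q A : Matrix m m K} {β γ : ι → K} (h : P * Q = 1)
    (hA : (P * A * Q).HasSpectralFactorization β γ) : A.HasSpectralFactorization β γ := by
  have h' : Q * P = 1 := mul_eq_one_comm.mp h
  obtain ⟨B, C, hBC, hB, hC⟩ := hA
  refine ⟨Q * B * P, Q * C * P, ?_, ?_, ?_⟩
  · calc A = (Q * P) * A * (Q * P) := by simp [h']
      _ = Q * (P * A * Q) * P := by simp only [mul_assoc]
      _ = Q * B * (P * Q) * C * P := by rw [hBC, h]; simp only [mul_assoc, one_mul]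
      _ = _ := by simp only [mul_assoc]
  · rw [charpoly_conj_of_mul_eq_one h, hB]
  · rw [charpoly_conj_of_mul_eq_one h, hC]

theorem HasSpectralFactorization.of_reindex {l : Type*} [Fintype l] [DecidableEq l]
    {A : Matrix m m K} {β γ : ι → K} (e : m ≃ l)
    (hA : (reindex e e A).HasSpectralFactorization β γ) : A.HasSpectralFactorization β γ := by
  obtain ⟨B, C, hBC, hB, hC⟩ := hA
  refine ⟨reindex e.symm e.symm B, reindex e.symm e.symm C, ?_, ?_, ?_⟩
  · apply (reindex e e).injective
    rw [hBC]
    simp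
  · rw [charpoly_reindex, hB]
  · rw [charpoly_reindex, hC]

theorem exists_conj_apply_ne_zero {A : Matrix m m K} (hA : A ∉ Set.range (scalar m)) :
    ∃ P Q : Matrix m m K, P * Q = 1 ∧ ∃ i j, i ≠ j ∧ (P * A * Q) i j ≠ 0 := by
  by_cases h : ∃ i j, i ≠ j ∧ A i j ≠ 0
  · exact ⟨1, 1, by simp, by simpa using h⟩
  push Not at h
  have : ∃ i j, A i i ≠ A j j := by
    by_contra! h2
    apply hA
    rcases isEmpty_or_nonempty m with hm | ⟨⟨i⟩⟩
    · exact ⟨0, Subsingleton.elim _ _⟩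
    · refine ⟨A i i, ?_⟩
      ext k l
      by_cases hkl : k = l
      · subst hkl; simp [h2 i k]
      · simp [h k l hkl, hkl]
  obtain ⟨i, j, hij⟩ := this
  have hne : i ≠ j := fun h => hij (by rw [h])
  -- For diagonal `A`, this conjugation creates the entry `A j j - A i i` at `(i, j)`.
  refine ⟨transvection i j 1, transvection i j (-1), ?_, i, j, hne, ?_⟩
  · rw [transvection_mul_transvection_same _ _ hne]; simp
  · simp [transvection, mul_add, add_mul, h i j hne, h j i hne.symm, sub_eq_zero, hij.symm,
      Matrix.mul_assoc, ← sub_eq_add_neg]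

end

/-! ### Shears, Schur complements and Sourour's factorization -/

section
variable {K m : Type*} [Field K] [Fintype m] [DecidableEq m]

theorem shear_mul_shear_neg (y : Matrix Unit m K) :
    fromBlocks 1 y 0 1 * fromBlocks 1 (-y) 0 1 = (1 : Matrix (Unit ⊕ m) (Unit ⊕ m) K) := by
  simp [fromBlocks_multiply, ← fromBlocks_one]

theorem shear_conj (a : Matrix Unit Unit K) (b y : Matrix Unit m K) (c : Matrix m Unit K)
    (D : Matrix m m K) :
    fromBlocks 1 y 0 1 * fromBlocks a b c D * fromBlocks 1 (-y) 0 1 =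
      fromBlocks (a + y * c) (b + y * D - (a + y * c) * y) c (D - c * y) := by
  simp only [fromBlocks_multiply]
  congr 1 <;> simp <;> abel

theorem exists_row_mul_col_eq {c : Matrix m Unit K} (hc : c ≠ 0) (t : K) :
    ∃ y : Matrix Unit m K, y * c = t • 1 := by
  obtain ⟨i, hi⟩ : ∃ i, c i () ≠ 0 := by
    by_contra! h
    exact hc (by ext i j; exact h i)
  refine ⟨of fun _ k => if k = i then t / c i () else 0, ?_⟩
  ext
  simp [mul_apply, hi]

theorem exists_ne_zero_row_mul_col_eq_zero (hm : 1 < Fintype.card m) {c : Matrix m Unit K}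
    (hc : c ≠ 0) : ∃ y : Matrix Unit m K, y ≠ 0 ∧ y * c = 0 := by
  obtain ⟨i, hi⟩ : ∃ i, c i () ≠ 0 := by
    by_contra! h
    exact hc (by ext i j; exact h i)
  obtain ⟨j, hj⟩ := Fintype.exists_ne_of_one_lt_card hm i
  refine ⟨of fun _ k => if k = i then - c j () else if k = j then c i () else 0, ?_, ?_⟩
  · intro h
    have := congrFun (congrFun h ()) j
    simp [hj, hi] at this
  · ext
    simp only [mul_apply, of_apply, zero_apply]
    rw [← Finset.sum_subset (Finset.subset_univ {i, j}) (by
      intro k _ hk; simp at hk; simp [hk.1, hk.2]), Finset.sum_pair hj.symm]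
    simp [hj]; ring

theorem col_mul_row_notMem_range_scalar {c : Matrix m Unit K} {y : Matrix Unit m K} (hc : c ≠ 0)
    (hy : y ≠ 0) (hyc : y * c = 0) : c * y ∉ Set.range (scalar m) := by
  rintro ⟨t, ht⟩
  have h1 : t • c = 0 := by
    have : c * y * c = 0 := by rw [Matrix.mul_assoc, hyc, Matrix.mul_zero]
    rwa [← ht, scalar_apply, ← smul_eq_diagonal_mul] at this
  have h2 : t = 0 := (smul_eq_zero.mp h1).resolve_right hc
  rw [h2, map_zero] at ht
  obtain ⟨i, hi⟩ : ∃ i, c i () ≠ 0 := by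
    by_contra! h
    exact hc (by ext i j; exact h i)
  apply hy
  ext u j
  have := congrFun (congrFun ht i) j
  simpa [mul_apply, hi] using this.symm

theorem det_fromBlocks_smul_one {t : K} (ht : t ≠ 0) (b : Matrix Unit m K) (c : Matrix m Unit K)
    (D : Matrix m m K) :
    (fromBlocks (t • (1 : Matrix Unit Unit K)) b c D).det = t * (D - t⁻¹ • (c * b)).det := by
  let _ : Invertible (t • (1 : Matrix Unit Unit K)) :=
    ⟨t⁻¹ • 1, by simp [ht], by simp [ht]⟩
  have : ⅟(t • (1 : Matrix Unit Unit K)) = t⁻¹ • 1 := rfl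
  rw [det_fromBlocks₁₁, this]
  simp

/-- A block matrix with nonzero lower left column is similar to one with prescribed corner and
nonscalar Schur complement. -/
theorem exists_conj_corner (hm : 1 < Fintype.card m) (a : Matrix Unit Unit K)
    (b : Matrix Unit m K) {c : Matrix m Unit K} (D : Matrix m m K) (hc : c ≠ 0)
    (hdet : (fromBlocks a b c D).det ≠ 0) {t : K} (ht : t ≠ 0) :
    ∃ P Q : Matrix (Unit ⊕ m) (Unit ⊕ m) K, P * Q = 1 ∧ ∃ b' D',
      P * fromBlocks a b c D * Q = fromBlocks (t • 1) b' c D' ∧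
      D' - t⁻¹ • (c * b') ∉ Set.range (scalar m) := by
  obtain ⟨y, hy⟩ := exists_row_mul_col_eq hc (t - a () ())
  have ha : a + y * c = t • 1 := by ext; simp [hy]
  have h1 := shear_conj a b y c D
  rw [ha, Matrix.smul_mul, Matrix.one_mul] at h1
  generalize b + y * D - t • y = b₁ at h1
  generalize D - c * y = D₁ at h1
  by_cases hS : D₁ - t⁻¹ • (c * b₁) ∈ Set.range (scalar m)
  swap
  · exact ⟨_, _, shear_mul_shear_neg y, b₁, D₁, h1, hS⟩
  obtain ⟨s, hs⟩ := hS
  have hs0 : s ≠ 0 := by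
    rintro rfl
    rw [← det_mul_mul_of_mul_eq_one (shear_mul_shear_neg y), h1, det_fromBlocks_smul_one ht, ← hs]
      at hdet
    have : Nonempty m := Fintype.card_pos_iff.mp (by omega)
    simp at hdet
  -- If the Schur complement is the scalar `s`, a second shear along `z` with `z * c = 0` keeps the
  -- corner and subtracts a nonzero multiple of the nonscalar matrix `c * z`.
  obtain ⟨z, hz, hzc⟩ := exists_ne_zero_row_mul_col_eq_zero hm hc
  have h2 := shear_conj (t • 1) b₁ z c D₁
  rw [hzc, add_zero, Matrix.smul_mul, Matrix.one_mul] at h2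
  have hzD : z * D₁ = s • z := by
    have : D₁ = scalar m s + t⁻¹ • (c * b₁) := by rw [hs]; abel
    rw [this, Matrix.mul_add, Matrix.mul_smul, ← Matrix.mul_assoc, hzc]
    simp [← smul_eq_mul_diagonal]
  refine ⟨fromBlocks 1 z 0 1 * fromBlocks 1 y 0 1, fromBlocks 1 (-y) 0 1 * fromBlocks 1 (-z) 0 1,
    ?_, b₁ + z * D₁ - t • z, D₁ - c * z, ?_, ?_⟩
  · rw [Matrix.mul_assoc, ← Matrix.mul_assoc _ _ (fromBlocks 1 (-z) 0 1), shear_mul_shear_neg,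
      Matrix.one_mul, shear_mul_shear_neg]
  · rw [← h2, ← h1]; simp only [Matrix.mul_assoc]
  · have key : D₁ - c * z - t⁻¹ • (c * (b₁ + z * D₁ - t • z)) =
        scalar m s - (t⁻¹ * s) • (c * z) := by
      rw [hs, hzD]
      simp only [Matrix.mul_add, Matrix.mul_sub, Matrix.mul_smul,
        smul_add, smul_sub, smul_smul, inv_mul_cancel₀ ht, one_smul]
      abel
    rw [key]
    rintro ⟨r, hr⟩
    apply col_mul_row_notMem_range_scalar hc hz hzc
    refine ⟨t * s⁻¹ * (s - r), ?_⟩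
    have : (t⁻¹ * s) • (c * z) = scalar m (s - r) := by rw [map_sub, hr]; abel
    have h3 : c * z = (t * s⁻¹) • ((t⁻¹ * s) • (c * z)) := by
      rw [smul_smul]
      have : t * s⁻¹ * (t⁻¹ * s) = 1 := by field_simp
      rw [this, one_smul]
    rw [h3, this]
    ext i j
    by_cases hij : i = j <;> simp [hij]

/-- Block LU: a lower triangular factor with corner `β 0` times an upper triangular one with corner
`γ 0`, the factors of the Schur complement being their remaining diagonal blocks. -/
theorem HasSpectralFactorization.fromBlocks {n : ℕ} {β γ : Fin (n + 1) → K} (hβ : β 0 ≠ 0)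
    (hγ : γ 0 ≠ 0) {b : Matrix Unit m K} {c : Matrix m Unit K} {D : Matrix m m K}
    (h : (D - (β 0 * γ 0)⁻¹ • (c * b)).HasSpectralFactorization
      (fun i : Fin n => β i.succ) (fun i : Fin n => γ i.succ)) :
    (fromBlocks ((β 0 * γ 0) • 1) b c D).HasSpectralFactorization β γ := by
  obtain ⟨B, C, hBC, hB, hC⟩ := h
  have hu (x : K) : (x • (1 : Matrix Unit Unit K)).charpoly =
      Polynomial.X - Polynomial.C x := by
    simp [charpoly]
  refine ⟨Matrix.fromBlocks (β 0 • 1) 0 ((γ 0)⁻¹ • c) B,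
    Matrix.fromBlocks (γ 0 • 1) ((β 0)⁻¹ • b) 0 C, ?_, ?_, ?_⟩
  · rw [fromBlocks_multiply, ← hBC]
    congr 1
    · simp [smul_smul, mul_comm]
    · simp [smul_smul, hβ]
    · simp [smul_smul, hγ]
    · simp [smul_smul, mul_comm]
  · rw [charpoly_fromBlocks_zero₁₂, hu, hB, Fin.prod_univ_succ]
  · rw [charpoly_fromBlocks_zero₂₁, hu, hC, Fin.prod_univ_succ]

end

/-- Induction through the Schur complement. Size at most 1 is allowed separately because such
matrices are always scalar, yet the determinant alone settles them. -/
theorem hasSpectralFactorization_of_notMem_range_scalar {K : Type*} [Field K] {n : ℕ}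
    (A : Matrix (Fin n) (Fin n) K) (hA : n ≤ 1 ∨ A ∉ Set.range (scalar (Fin n))) (β γ : Fin n → K)
    (hβ : ∀ i, β i ≠ 0) (hγ : ∀ i, γ i ≠ 0) (hdet : A.det = ∏ i, β i * γ i) :
    A.HasSpectralFactorization β γ := by
  induction n with
  | zero => exact ⟨1, 1, Subsingleton.elim _ _, by simp, by simp⟩
  | succ n ih =>
    have hdet0 : A.det ≠ 0 := by
      rw [hdet]; exact Finset.prod_ne_zero_iff.mpr fun i _ => mul_ne_zero (hβ i) (hγ i)
    have ht : β 0 * γ 0 ≠ 0 := mul_ne_zero (hβ 0) (hγ 0)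
    rcases Nat.eq_zero_or_pos n with rfl | hn
    · refine ⟨diagonal β, diagonal γ, ?_, by simp [charpoly_diagonal], by simp [charpoly_diagonal]⟩
      ext i j
      fin_cases i; fin_cases j
      simpa using hdet
    have hA' := hA.resolve_left (by omega)
    obtain ⟨P, Q, hPQ, i, j, hij, hne⟩ := exists_conj_apply_ne_zero hA'
    apply HasSpectralFactorization.of_conj hPQ
    rw [← det_mul_mul_of_mul_eq_one hPQ] at hdet hdet0
    generalize P * A * Q = A₁ at *
    -- Column `j` becomes the first one, so the nonzero entry at `(i, j)` lands in the lower left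
    -- block.
    let e : Fin (n + 1) ≃ Unit ⊕ Fin n :=
      (Equiv.swap 0 j).trans
        (((finSuccEquiv n).trans (Equiv.optionEquivSumPUnit (Fin n))).trans (Equiv.sumComm _ _))
    have hej : e.symm (Sum.inl ()) = j := by simp [e]
    apply HasSpectralFactorization.of_reindex e
    rw [← det_reindex_self e] at hdet hdet0
    have hc : (reindex e e A₁).toBlocks₂₁ ≠ 0 := by
      intro h
      obtain ⟨u, hu⟩ | ⟨k, hk⟩ : (∃ u, e i = Sum.inl u) ∨ ∃ k, e i = Sum.inr k := by
        cases e i <;> simp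
      · exact hij (by rw [← hej, ← e.symm_apply_apply i, hu])
      · have := congrFun (congrFun h k) ()
        simp [toBlocks₂₁, hej, ← hk] at this
        exact hne this
    generalize reindex e e A₁ = A₂ at *
    rw [← fromBlocks_toBlocks A₂] at hdet hdet0 ⊢
    generalize A₂.toBlocks₁₁ = a at *
    generalize A₂.toBlocks₁₂ = b at *
    generalize A₂.toBlocks₂₁ = c at *
    generalize A₂.toBlocks₂₂ = D at *
    by_cases hn1 : n = 1
    · obtain ⟨y, hy⟩ := exists_row_mul_col_eq hc (β 0 * γ 0 - a () ())
      have ha : a + y * c = (β 0 * γ 0) • 1 := by ext; simp [hy]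
      apply HasSpectralFactorization.of_conj (shear_mul_shear_neg y)
      rw [← det_mul_mul_of_mul_eq_one (shear_mul_shear_neg y)] at hdet
      rw [shear_conj, ha] at hdet ⊢
      apply HasSpectralFactorization.fromBlocks (hβ 0) (hγ 0)
      apply ih _ (Or.inl hn1.le) _ _ (fun i => hβ _) (fun i => hγ _)
      rw [det_fromBlocks_smul_one ht, Fin.prod_univ_succ] at hdet
      exact mul_left_cancel₀ ht hdet
    · obtain ⟨P', Q', hPQ', b', D', hb', hS⟩ :=
        exists_conj_corner (by simp; omega) a b D hc hdet0 ht
      apply HasSpectralFactorization.of_conj hPQ'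
      rw [← det_mul_mul_of_mul_eq_one hPQ', hb', det_fromBlocks_smul_one ht, Fin.prod_univ_succ]
        at hdet
      rw [hb']
      apply HasSpectralFactorization.fromBlocks (hβ 0) (hγ 0)
      exact ih _ (Or.inr hS) _ _ (fun i => hβ _) (fun i => hγ _) (mul_left_cancel₀ ht hdet)

/-- A matrix whose characteristic polynomial has distinct roots is diagonalizable. -/
theorem exists_eq_conj_diagonal_of_charpoly_eq_prod {K m : Type*} [Field K] [Fintype m]
    [DecidableEq m] {B : Matrix m m K} {β : m → K} (hβ : Function.Injective β)
    (hB : B.charpoly = ∏ i, (Polynomial.X - Polynomial.C (β i))) :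
    ∃ P : GL m K, B = (P : Matrix m m K) * diagonal β * ((P⁻¹ : GL m K) : Matrix m m K) := by
  have hev (i : m) : ∃ v, Module.End.HasEigenvector (toLin' B) (β i) v := by
    apply Module.End.HasEigenvalue.exists_hasEigenvector
    rw [Module.End.hasEigenvalue_iff_isRoot_charpoly, ← LinearMap.charpoly_toMatrix _ (Pi.basisFun K m)]
    simp only [LinearMap.toMatrix_eq_toMatrix', LinearMap.toMatrix'_toLin', hB, Polynomial.IsRoot,
      Polynomial.eval_prod]
    exact Finset.prod_eq_zero (Finset.mem_univ i) (by simp)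
  choose v hv using hev
  have hli := Module.End.eigenvectors_linearIndependent' (toLin' B) β hβ v hv
  let M : Matrix m m K := (of v)ᵀ
  have hM : IsUnit M := by
    have h : LinearIndependent K M.col := hli
    exact linearIndependent_cols_iff_isUnit.mp h
  obtain ⟨P, hP⟩ := hM
  refine ⟨P, ?_⟩
  have key : B * P = P * diagonal β := by
    rw [hP]
    ext i j
    have := congrFun (hv j).apply_eq_smul i
    simp only [toLin'_apply, Pi.smul_apply, smul_eq_mul] at this
    rw [mul_diagonal, mul_comm]
    exact this
  rw [← key, mul_assoc, Units.mul_inv, mul_one]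

end Matrix

/-! ### Coninvolutions and fixed points of affine maps -/

namespace Aff
variable {n : ℕ}

theorem map_conj_mulVec (A : GL (Fin n) ℂ) (x : Fin n → ℂ) :
    (Matrix.GeneralLinearGroup.map (starRingEnd ℂ) A : Matrix (Fin n) (Fin n) ℂ) *ᵥ x =
      star ((A : Matrix (Fin n) (Fin n) ℂ) *ᵥ star x) := by
  ext i
  simp [Matrix.mulVec, dotProduct]

theorem conj_apply (g : Aff n) (x : Fin n → ℂ) : conj g x = star (g (star x)) := by
  conv_rhs => rw [← ofPair_linearPart_translationPart g]
  rw [conj, ofPair_apply, ofPair_apply, map_conj_mulVec, star_add]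

theorem conj_mul (g h : Aff n) : conj (g * h) = conj g * conj h := by
  ext1 x
  simp [conj_apply]

theorem conj_conj (g : Aff n) : conj (conj g) = g := by
  ext1 x
  simp [conj_apply]

theorem conj_one : conj (1 : Aff n) = 1 := by
  ext1 x
  simp [conj_apply]

theorem conj_inv (g : Aff n) : conj g⁻¹ = (conj g)⁻¹ := by
  apply eq_inv_of_mul_eq_one_left
  rw [← conj_mul, inv_mul_cancel, conj_one]

/-- A conjugate of a coninvolution is a product of two coninvolutions. -/
theorem exists_coninvolutions_of_conj {d : Aff n} (hd : IsConinvolution d) (h : Aff n) :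
    ∃ a b : Aff n, IsConinvolution a ∧ IsConinvolution b ∧ h * d * h⁻¹ = a * b := by
  refine ⟨h * d * (conj h)⁻¹, conj h * h⁻¹, ?_, ?_, by group⟩
  · rw [IsConinvolution, conj_mul, conj_mul, conj_inv, conj_conj]
    have : h * d * (conj h)⁻¹ * (conj h * conj d * h⁻¹) = h * (d * conj d) * h⁻¹ := by group
    rw [this, hd]
    group
  · rw [IsConinvolution, conj_mul, conj_inv, conj_conj]
    group

/-- An affine map with a fixed point whose linear part is similar to a unimodular diagonal matrix
is a product of two coninvolutions. -/
theorem exists_coninvolutions_of_fixed {g : Aff n} {P : GL (Fin n) ℂ} {d : Fin n → ℂ}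
    (hd : ∀ i, ‖d i‖ = 1)
    (hg : (linearPart g : Matrix (Fin n) (Fin n) ℂ) =
      (P : Matrix (Fin n) (Fin n) ℂ) * Matrix.diagonal d *
        ((P⁻¹ : GL (Fin n) ℂ) : Matrix (Fin n) (Fin n) ℂ))
    {p : Fin n → ℂ} (hp : g p = p) :
    ∃ a b : Aff n, IsConinvolution a ∧ IsConinvolution b ∧ g = a * b := by
  have hdd (i : Fin n) : d i * (starRingEnd ℂ) (d i) = 1 := by
    rw [Complex.mul_conj, Complex.normSq_eq_norm_sq, hd]; simp
  have hdd' (i : Fin n) : (starRingEnd ℂ) (d i) * d i = 1 := by rw [mul_comm, hdd]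
  let D : GL (Fin n) ℂ := ⟨Matrix.diagonal d, Matrix.diagonal (fun i => (starRingEnd ℂ) (d i)),
    by simp [Matrix.diagonal_mul_diagonal, hdd], by simp [Matrix.diagonal_mul_diagonal, hdd']⟩
  have hD : IsConinvolution (ofPair D 0) := by
    ext x i
    simp [conj_apply, D, Matrix.mulVec_diagonal, ← mul_assoc, hdd]
  -- `ofPair P p` moves the origin to the fixed point and the standard basis to the eigenbasis.
  have key : g = ofPair P p * ofPair D 0 * (ofPair P p)⁻¹ := by
    rw [eq_mul_inv_iff_mul_eq]
    ext1 x
    have hlin (u : Fin n → ℂ) : g (u + p) = g.linear u + g p := g.map_vadd p u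
    simp only [AffineEquiv.mul_def, AffineEquiv.trans_apply, ofPair_apply, add_zero, hlin, hp, ← linearPart_mulVec, hg,
      Matrix.mulVec_mulVec]
    rw [mul_assoc, ← Units.val_mul, inv_mul_cancel, Units.val_one, mul_one]
  rw [key]
  exact exists_coninvolutions_of_conj hD _

/-- Since 1 is not an eigenvalue, the fixed point equation is solved coordinatewise in the
eigenbasis. -/
theorem exists_fixed_of_conj_diagonal {g : Aff n} {P : GL (Fin n) ℂ} {d : Fin n → ℂ}
    (hd : ∀ i, d i ≠ 1)
    (hg : (linearPart g : Matrix (Fin n) (Fin n) ℂ) =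
      (P : Matrix (Fin n) (Fin n) ℂ) * Matrix.diagonal d *
        ((P⁻¹ : GL (Fin n) ℂ) : Matrix (Fin n) (Fin n) ℂ)) : ∃ p, g p = p := by
  let w : Fin n → ℂ := ((P⁻¹ : GL (Fin n) ℂ) : Matrix (Fin n) (Fin n) ℂ) *ᵥ translationPart g
  have hw : (P : Matrix (Fin n) (Fin n) ℂ) *ᵥ w = translationPart g := by
    rw [Matrix.mulVec_mulVec, ← Units.val_mul, mul_inv_cancel, Units.val_one, Matrix.one_mulVec]
  refine ⟨(P : Matrix (Fin n) (Fin n) ℂ) *ᵥ fun i => w i / (1 - d i), ?_⟩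
  rw [← ofPair_linearPart_translationPart g, ofPair_apply, hg, Matrix.mulVec_mulVec, mul_assoc,
    ← Units.val_mul, inv_mul_cancel, Units.val_one, mul_one, ← Matrix.mulVec_mulVec, ← hw,
    ← Matrix.mulVec_add]
  congr 1
  ext i
  have : 1 - d i ≠ 0 := sub_ne_zero.mpr (hd i).symm
  simp only [Pi.add_apply, Matrix.mulVec_diagonal]
  field_simp
  ring

/-- The whole translation goes to the factor `B`; the factor `C` fixes 0, so its spectrum may
contain 1. -/
theorem exists_coninvolutions_of_factorization {g : Aff n} {B C : GL (Fin n) ℂ}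
    (hg : linearPart g = B * C) {P Q : GL (Fin n) ℂ} {β γ : Fin n → ℂ}
    (hβ : ∀ i, ‖β i‖ = 1) (hβ1 : ∀ i, β i ≠ 1) (hγ : ∀ i, ‖γ i‖ = 1)
    (hB : (B : Matrix (Fin n) (Fin n) ℂ) = (P : Matrix (Fin n) (Fin n) ℂ) * Matrix.diagonal β *
      ((P⁻¹ : GL (Fin n) ℂ) : Matrix (Fin n) (Fin n) ℂ))
    (hC : (C : Matrix (Fin n) (Fin n) ℂ) = (Q : Matrix (Fin n) (Fin n) ℂ) * Matrix.diagonal γ *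
      ((Q⁻¹ : GL (Fin n) ℂ) : Matrix (Fin n) (Fin n) ℂ)) :
    ∃ l : List (Aff n), l.length ≤ 4 ∧ (∀ h ∈ l, IsConinvolution h) ∧ g = l.prod := by
  have h1 : linearPart (ofPair B (translationPart g)) = B := linearPart_ofPair _ _
  have h2 : linearPart (ofPair C 0) = C := linearPart_ofPair _ _
  rw [← h1] at hB
  rw [← h2] at hC
  obtain ⟨p, hp⟩ := exists_fixed_of_conj_diagonal hβ1 hB
  obtain ⟨a, b, ha, hb, hab⟩ := exists_coninvolutions_of_fixed hβ hB hp
  obtain ⟨c, d, hc, hd, hcd⟩ := exists_coninvolutions_of_fixed (p := 0) hγ hC (by simp)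
  refine ⟨[a, b, c, d], by simp, by simp [ha, hb, hc, hd], ?_⟩
  have : g = ofPair B (translationPart g) * ofPair C 0 := by
    conv_lhs => rw [← ofPair_linearPart_translationPart g]
    ext1 x
    simp [hg, Matrix.mulVec_mulVec]
  rw [this, hab, hcd]
  simp [mul_assoc]

end Aff

/-! ### Choice of the spectra and conclusion -/

/-- A unimodular number is a product of distinct unimodular numbers `β i ≠ 1` and distinct
unimodular numbers `γ i`. -/
theorem Complex.exists_injective_unimodular_prod_eq {n : ℕ} (hn : n ≠ 0) {z : ℂ} (hz : ‖z‖ = 1) :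
    ∃ β γ : Fin n → ℂ, Function.Injective β ∧ Function.Injective γ ∧ (∀ i, ‖β i‖ = 1) ∧
      (∀ i, β i ≠ 1) ∧ (∀ i, ‖γ i‖ = 1) ∧ z = ∏ i, β i * γ i := by
  obtain ⟨ζ, hζ⟩ : ∃ ζ : ℂ, IsPrimitiveRoot ζ (n + 1) :=
    ⟨_, Complex.isPrimitiveRoot_exp (n + 1) (by omega)⟩
  have hζ1 : ‖ζ‖ = 1 := hζ.norm'_eq_one (by omega)
  -- All the `(n + 1)`-th roots of unity except 1.
  let β : Fin n → ℂ := fun i => ζ ^ (i.val + 1)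
  have hβ (i) : ‖β i‖ = 1 := by simp [β, hζ1]
  have hinj : Function.Injective β := by
    intro i j h
    have := hζ.pow_inj (by omega) (by omega) h
    exact Fin.ext (by omega)
  have hprod : ‖∏ i, β i * β i‖ = 1 := by simp [norm_prod, hβ]
  have hprod0 : ∏ i, β i * β i ≠ 0 := by
    intro h; rw [h] at hprod; simp at hprod
  -- Rotating the second family by `w` multiplies the product by `w ^ n`, which corrects it to `z`.
  obtain ⟨w, hw⟩ := IsAlgClosed.exists_pow_nat_eq (z / ∏ i, β i * β i) (Nat.pos_of_ne_zero hn)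
  have hw1 : ‖w‖ = 1 := by
    have : ‖w‖ ^ n = 1 := by rw [← norm_pow, hw, norm_div, hz, hprod, div_one]
    exact (pow_eq_one_iff_of_nonneg (norm_nonneg _) hn).mp this
  have hw0 : w ≠ 0 := by
    rintro rfl; simp at hw1
  refine ⟨β, fun i => w * β i, hinj, fun i j h => hinj (mul_left_cancel₀ hw0 h), hβ, ?_, ?_, ?_⟩
  · intro i
    exact hζ.pow_ne_one_of_pos_of_lt (by omega) (by omega)
  · intro i; simp [hw1, hβ]
  · have : ∏ i, β i * (w * β i) = w ^ n * ∏ i, β i * β i := by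
      simp only [Finset.prod_mul_distrib, Finset.prod_const, Finset.card_univ, Fintype.card_fin]
      ring
    rw [this, hw, div_mul_cancel₀ _ hprod0]

theorem theorem3 (n : ℕ) (g : Aff n)
    (hg : ‖(Aff.linearPart g : Matrix (Fin n) (Fin n) ℂ).det‖ = 1) :
    ∃ l : List (Aff n), l.length ≤ 4 ∧ (∀ h ∈ l, Aff.IsConinvolution h) ∧ g = l.prod := by
  by_cases hs : (Aff.linearPart g : Matrix (Fin n) (Fin n) ℂ) ∈ Set.range (Matrix.scalar (Fin n))
  · obtain ⟨s, hs⟩ := hs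
    refine Aff.exists_coninvolutions_of_factorization (g := g) (B := -1)
      (C := -Aff.linearPart g) (P := 1) (Q := 1) (β := fun _ => -1) (γ := fun _ => -s)
      (by simp) (by simp) (fun _ => by norm_num) ?_ ?_ ?_
    · intro i
      have hn : n ≠ 0 := fun h => by subst h; exact i.elim0
      rw [← hs] at hg
      simp only [Matrix.scalar_apply, Matrix.det_diagonal, Finset.prod_const, Finset.card_univ,
        Fintype.card_fin, norm_pow] at hg
      rw [norm_neg]
      exact (pow_eq_one_iff_of_nonneg (norm_nonneg _) hn).mp hg
    · ext i j
      by_cases hij : i = j <;> simp [hij]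
    · rw [Units.val_neg, ← hs]
      ext i j
      by_cases hij : i = j <;> simp [hij]
  -- In dimension 0 the only matrix is scalar.
  · have hn : n ≠ 0 := by
      rintro rfl
      exact hs ⟨0, Subsingleton.elim _ _⟩
    obtain ⟨β, γ, hβi, hγi, hβ, hβ1, hγ, hdet⟩ :=
      Complex.exists_injective_unimodular_prod_eq hn hg
    have ne_zero {z : ℂ} (h : ‖z‖ = 1) : z ≠ 0 := by rintro rfl; simp at h
    obtain ⟨B, C, hBC, hB, hC⟩ := Matrix.hasSpectralFactorization_of_notMem_range_scalar _
      (Or.inr hs) β γ (fun i => ne_zero (hβ i)) (fun i => ne_zero (hγ i)) hdet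
    have hu : IsUnit (B * C) := hBC ▸ (Aff.linearPart g).isUnit
    rw [Matrix.isUnit_iff_isUnit_det, Matrix.det_mul, IsUnit.mul_iff,
      ← Matrix.isUnit_iff_isUnit_det, ← Matrix.isUnit_iff_isUnit_det] at hu
    obtain ⟨⟨B, rfl⟩, ⟨C, rfl⟩⟩ := hu
    obtain ⟨P, hP⟩ := Matrix.exists_eq_conj_diagonal_of_charpoly_eq_prod hβi hB
    obtain ⟨Q, hQ⟩ := Matrix.exists_eq_conj_diagonal_of_charpoly_eq_prod hγi hC
    exact Aff.exists_coninvolutions_of_factorization (Units.ext hBC) hβ hβ1 hγ hP hQ
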